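/- For positive integers $m,n$ let $a_1,\dots,a_m\in\mathbb{R}^n$ be independent random vectors, each uniformly distributed on $\{\pm 1/\sqrt n\}^n$. For real polynomials $p,q$ in $x=(x_1,\dots,x_n)$, a degree-$d$ sum-of-squares proof of $p(x)\le q(x)$ under the constraint $\|x\|^2=1$ consists of real polynomials $h_1,\dots,h_\ell,g$ with $$q(x)-p(x)=\sum_{i=1}^{\ell}h_i(x)^2+(\|x\|^2-1)\,g(x),$$ where $\deg(q-p)\le d$, $\deg h_i\le d/2$ for all $i$, and $\deg\big((\|x\|^2-1)g\big)\le d$. Then $\sum_{i=1}^m\langle a_i,x\rangle^4\le 1+\tilde O(m/n^{3/2})$ has, with high probability over the $a_i$, a degree-12 sum-of-squares proof under the constraint $\|x\|^2=1$. Precisely: there are absolute constants $c>0$ and $k\in\mathbb{N}$ such that for every $K\in\mathbb{N}$ there is an $N$ such that for all $n\ge N$ and all $m$, with probability at least $1-n^{-K}$ over $a_1,\dots,a_m$, there is a degree-12 sum-of-squares proof, under the constraint $\|x\|^2=1$, of $$\sum_{i=1}^m\langle a_i,x\rangle^4\;\le\;1+c\,\log^k(n+m)\,\frac{m}{n^{3/2}}.$$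 -/

import Mathlib

open MeasureTheory ProbabilityTheory

noncomputable section

/-- `SoSLE r d p q` : there is a degree-`d` sum-of-squares proof of `p(x) ≤ q(x)` under the
polynomial equality constraints `r j (x) = 0`, i.e. `q - p` is a sum of squares of polynomials of
degree at most `d / 2` modulo multiples of the `r j` of degree at most `d`. -/
def SoSLE {n t : ℕ} (r : Fin t → MvPolynomial (Fin n) ℝ) (d : ℕ)
    (p q : MvPolynomial (Fin n) ℝ) : Prop :=
  ∃ (l : ℕ) (h : Fin l → MvPolynomial (Fin n) ℝ) (g : Fin t → MvPolynomial (Fin n) ℝ),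
    (q - p).totalDegree ≤ d ∧
    (∀ i, 2 * (h i).totalDegree ≤ d) ∧
    (∀ j, (r j * g j).totalDegree ≤ d) ∧
    q - p = ∑ i, h i ^ 2 + ∑ j, r j * g j

/-- The polynomial `‖x‖² - 1` in the indeterminates `x = (x₁, …, xₙ)`. -/
def unitSpherePoly (n : ℕ) : MvPolynomial (Fin n) ℝ :=
  ∑ k, MvPolynomial.X k ^ 2 - 1

/-- The linear polynomial `⟨v, x⟩` in the indeterminates `x = (x₁, …, xₙ)`. -/
def innerPoly {n : ℕ} (v : Fin n → ℝ) : MvPolynomial (Fin n) ℝ :=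
  ∑ k, MvPolynomial.C (v k) * MvPolynomial.X k

/-- The scaled hypercube `{± 1 / √n}ⁿ`. -/
def signCube (n : ℕ) : Set (Fin n → ℝ) :=
  {v | ∀ k, v k = 1 / Real.sqrt n ∨ v k = -(1 / Real.sqrt n)}

/-- The law of `m` independent vectors `a₁, …, aₘ`, each uniform on `{± 1 / √n}ⁿ`. -/
def componentLaw (m n : ℕ) : Measure (Fin m → Fin n → ℝ) :=
  Measure.pi fun _ => uniformOn (signCube n)

end

/-! Write `w_i = ⟨a_i, x⟩²`, `Y = ∑ w_i`, `S = ∑ ⟨a_i, x⟩⁴`, `r = ‖x‖²`. Expanding the sum of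
squares `‖∑ w_i a_i ⊗ a_i - x ⊗ x‖²` gives `2 S ≤ r² + ∑_{i,j} ⟨a_i, a_j⟩² w_i w_j`. For unit
vectors of coherence at most `g`, the double sum is at most `S + g² (Y² - S)`, with a difference
that is a nonnegative combination of the squares `w_i w_j`. A frame bound `Y ≤ t r` gives `Y² ≤ t²
r²`. Hence `(1 + g²) S ≤ (1 + g² t²) r²`, by a certificate of degree only 4
(`sum_innerPoly_pow_four_certificate`).

With `L = log (n + m)`, Hoeffding and a union bound give `g = L / √n`. A subfamily `T` has `t = (1 +
|T| / n) L` with high probability, from exponential moments and volume averaging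
(`componentLaw_frame_bound_fails_le`).

Three ranges of `m` remain. For `√n ≤ m ≤ n^(3/2)` the excess `g² t²` is already `O(L⁴ m /
n^(3/2))`. For `m ≤ √n` this `t` is too weak, and Gershgorin supplies `t = 1 + m g`. For larger `m`
the vectors are cut into blocks of about `n^(3/2)`, each contributing `O(L⁴)`. Only coherence and
the frame bounds of the blocks are random. -/

/-! ### Sums of squares of bounded degree -/

open MvPolynomial in
theorem totalDegree_innerPoly_le {n : ℕ} (v : Fin n → ℝ) : (innerPoly v).totalDegree ≤ 1 := by
  refine totalDegree_finsetSum_le fun k _ => (totalDegree_mul _ _).trans ?_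
  simp

/-- The polynomial `‖x‖²`. -/
noncomputable def normSqPoly (n : ℕ) : MvPolynomial (Fin n) ℝ :=
  ∑ k, MvPolynomial.X k ^ 2

/-- The cone of sums of squares of polynomials of degree at most `e`. -/
noncomputable def sosCone (n e : ℕ) : AddSubmonoid (MvPolynomial (Fin n) ℝ) :=
  AddSubmonoid.closure {p | ∃ h : MvPolynomial (Fin n) ℝ, h.totalDegree ≤ e ∧ p = h ^ 2}

theorem sq_mem_sosCone {n e : ℕ} {h : MvPolynomial (Fin n) ℝ} (hh : h.totalDegree ≤ e) :
    h ^ 2 ∈ sosCone n e :=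
  AddSubmonoid.subset_closure ⟨h, hh, rfl⟩

open MvPolynomial in
theorem C_mul_mem_sosCone {n e : ℕ} {c : ℝ} (hc : 0 ≤ c) {p : MvPolynomial (Fin n) ℝ}
    (hp : p ∈ sosCone n e) : C c * p ∈ sosCone n e := by
  induction hp using AddSubmonoid.closure_induction with
  | mem p hp =>
    obtain ⟨h, hh, rfl⟩ := hp
    have : C c * h ^ 2 = (C (Real.sqrt c) * h) ^ 2 := by
      rw [mul_pow, ← C_pow, Real.sq_sqrt hc]
    rw [this]
    exact sq_mem_sosCone ((totalDegree_mul _ _).trans (by simpa using hh))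
  | zero => simp
  | add p q _ _ hp hq => rw [mul_add]; exact add_mem hp hq

open MvPolynomial in
theorem mul_mem_sosCone {n e f : ℕ} {p q : MvPolynomial (Fin n) ℝ}
    (hp : p ∈ sosCone n e) (hq : q ∈ sosCone n f) : p * q ∈ sosCone n (e + f) := by
  induction hp using AddSubmonoid.closure_induction with
  | mem p hp =>
    obtain ⟨h, hh, rfl⟩ := hp
    induction hq using AddSubmonoid.closure_induction with
    | mem q hq =>
      obtain ⟨k, hk, rfl⟩ := hq
      rw [← mul_pow]
      exact sq_mem_sosCone ((totalDegree_mul _ _).trans (add_le_add hh hk))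
    | zero => simp
    | add p q _ _ hp hq => rw [mul_add]; exact add_mem hp hq
  | zero => simp
  | add p q _ _ hp hq => rw [add_mul]; exact add_mem hp hq

theorem mul_mem_sosCone_two {n : ℕ} {p q : MvPolynomial (Fin n) ℝ}
    (hp : p ∈ sosCone n 1) (hq : q ∈ sosCone n 1) : p * q ∈ sosCone n 2 :=
  mul_mem_sosCone (e := 1) (f := 1) hp hq

theorem exists_sum_sq_of_mem_sosCone {n e : ℕ} {p : MvPolynomial (Fin n) ℝ}
    (hp : p ∈ sosCone n e) :
    ∃ (l : ℕ) (h : Fin l → MvPolynomial (Fin n) ℝ),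
      (∀ i, (h i).totalDegree ≤ e) ∧ p = ∑ i, h i ^ 2 := by
  induction hp using AddSubmonoid.closure_induction with
  | mem p hp =>
    obtain ⟨h, hh, rfl⟩ := hp
    exact ⟨1, fun _ => h, fun _ => hh, by simp⟩
  | zero => exact ⟨0, Fin.elim0, fun i => i.elim0, by simp⟩
  | add p q _ _ hp hq =>
    obtain ⟨l, h, hh, rfl⟩ := hp
    obtain ⟨l', h', hh', rfl⟩ := hq
    refine ⟨l + l', Fin.append h h', fun i => ?_, by simp [Fin.sum_univ_add]⟩
    refine Fin.addCases (fun i => ?_) (fun i => ?_) i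
    · simpa using hh i
    · simpa using hh' i

theorem normSqPoly_mem_sosCone (n : ℕ) : normSqPoly n ∈ sosCone n 1 :=
  sum_mem fun k _ => sq_mem_sosCone (by simp)

theorem totalDegree_normSqPoly_le (n : ℕ) : (normSqPoly n).totalDegree ≤ 2 :=
  MvPolynomial.totalDegree_finsetSum_le fun k _ => by simp

open MvPolynomial in
/-- A homogeneous certificate `q ‖x‖⁴ - p` turns into a proof of `p ≤ q` on the sphere. -/
theorem soSLE_of_mem_sosCone {n : ℕ} {p : MvPolynomial (Fin n) ℝ} {q q' : ℝ} (hqq : q ≤ q')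
    (hp : p.totalDegree ≤ 4) (h : C q * normSqPoly n ^ 2 - p ∈ sosCone n 2) :
    SoSLE (fun _ : Fin 1 => unitSpherePoly n) 12 p (C q') := by
  have hr : normSqPoly n ^ 2 ∈ sosCone n 2 := sq_mem_sosCone (totalDegree_normSqPoly_le n)
  have h' : C q' * normSqPoly n ^ 2 - p ∈ sosCone n 2 := by
    have := add_mem h (C_mul_mem_sosCone (sub_nonneg.2 hqq) hr)
    rw [C_sub] at this
    convert this using 1
    ring
  obtain ⟨l, h, hh, he⟩ := exists_sum_sq_of_mem_sosCone h'
  have hu : unitSpherePoly n = normSqPoly n - 1 := rfl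
  have hu2 : (unitSpherePoly n).totalDegree ≤ 2 := by
    rw [hu]
    exact (totalDegree_sub _ _).trans (max_le (totalDegree_normSqPoly_le n) (by simp))
  -- The multiplier comes from `q' - q' r² = -q' (r - 1) (r + 1)` with `r = ‖x‖²`.
  refine ⟨l, h, fun _ => -(C q' * (normSqPoly n + 1)), ?_, fun i => ?_, fun _ => ?_, ?_⟩
  · refine (totalDegree_sub _ _).trans (max_le (by simp) (hp.trans (by norm_num)))
  · have := hh i
    omega
  · refine (totalDegree_mul _ _).trans ?_
    rw [totalDegree_neg]
    have h1 : (C q' * (normSqPoly n + 1)).totalDegree ≤ 0 + 2 := by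
      refine (totalDegree_mul _ _).trans (add_le_add (by simp) ?_)
      exact (totalDegree_add _ _).trans (max_le (totalDegree_normSqPoly_le n) (by simp))
    change (unitSpherePoly n).totalDegree + _ ≤ 12
    omega
  · rw [← he]
    simp only [Finset.univ_unique, Finset.sum_singleton, hu]
    ring

/-! ### Quadratic forms as sums of squares -/

open MvPolynomial in
theorem sum_innerPoly_sq {n : ℕ} {ι : Type*} (T : Finset ι) (b : ι → Fin n → ℝ) :
    ∑ i ∈ T, innerPoly (b i) ^ 2
      = ∑ k, ∑ l, C (∑ i ∈ T, b i k * b i l) * (X k * X l) := by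
  have h : ∀ i, innerPoly (b i) ^ 2 = ∑ k, ∑ l, C (b i k * b i l) * (X k * X l) := by
    intro i
    rw [innerPoly, sq, Finset.sum_mul_sum]
    refine Finset.sum_congr rfl fun k _ => Finset.sum_congr rfl fun l _ => ?_
    rw [C_mul]; ring
  simp only [h, map_sum, Finset.sum_mul]
  rw [Finset.sum_comm]
  exact Finset.sum_congr rfl fun k _ => Finset.sum_comm

open MvPolynomial Matrix MatrixOrder in
/-- A positive semidefinite quadratic form is a sum of squares of linear forms. -/
theorem posSemidef_mem_sosCone {n : ℕ} {M : Matrix (Fin n) (Fin n) ℝ} (hM : M.PosSemidef) :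
    ∑ k, ∑ l, C (M k l) * (X k * X l) ∈ sosCone n 1 := by
  obtain ⟨B, hB⟩ := CStarAlgebra.nonneg_iff_eq_star_mul_self.1 hM.nonneg
  have : ∑ k, ∑ l, C (M k l) * (X k * X l)
      = ∑ j, (innerPoly fun k => B j k : MvPolynomial (Fin n) ℝ) ^ 2 := by
    rw [sum_innerPoly_sq Finset.univ fun j k => B j k, hB]
    simp [mul_apply, star_apply]
  rw [this]
  exact sum_mem fun j _ => sq_mem_sosCone (totalDegree_innerPoly_le _)

-- For quadratic forms, pointwise nonnegativity already yields a sum of squares. This turns a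
-- numerical frame bound into a certificate.
open MvPolynomial Matrix in
theorem normSqPoly_sub_sum_sq_mem_sosCone {n : ℕ} {ι : Type*} (T : Finset ι)
    (a : ι → Fin n → ℝ) {t : ℝ} (h : ∀ x : Fin n → ℝ, ∑ i ∈ T, (a i ⬝ᵥ x) ^ 2 ≤ t * (x ⬝ᵥ x)) :
    C t * normSqPoly n - ∑ i ∈ T, innerPoly (a i) ^ 2 ∈ sosCone n 1 := by
  have hM : (t • (1 : Matrix (Fin n) (Fin n) ℝ) - ∑ i ∈ T, vecMulVec (a i) (a i)).PosSemidef := by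
    refine Matrix.PosSemidef.of_dotProduct_mulVec_nonneg ?_ fun x => ?_
    · ext k l
      simp [Matrix.sum_apply, vecMulVec_apply, Matrix.one_apply, eq_comm, mul_comm]
    · have h1 : x ⬝ᵥ ((∑ i ∈ T, vecMulVec (a i) (a i)) *ᵥ x) = ∑ i ∈ T, (a i ⬝ᵥ x) ^ 2 := by
        rw [Matrix.sum_mulVec, dotProduct_sum]
        refine Finset.sum_congr rfl fun i _ => ?_
        rw [vecMulVec_mulVec, dotProduct_comm]
        simp [sq]
      simp only [star_trivial, sub_mulVec, smul_mulVec, one_mulVec, dotProduct_sub,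
        dotProduct_smul, h1, smul_eq_mul, sub_nonneg]
      exact h x
  convert posSemidef_mem_sosCone hM using 1
  simp only [Matrix.sub_apply, Matrix.smul_apply, Matrix.sum_apply, vecMulVec_apply, C_sub, sub_mul,
    Finset.sum_sub_distrib]
  congr 1
  · simp only [normSqPoly, Finset.mul_sum]
    refine Finset.sum_congr rfl fun k _ => ?_
    rw [Finset.sum_eq_single k] <;> simp +contextual [sq, eq_comm]
  · exact sum_innerPoly_sq T a

/-! ### The quartic certificate -/

/-- Expansion of `‖∑ wᵢ cᵢ ⊗ cᵢ - x ⊗ x‖²`. -/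
theorem sum_sq_tensor_sub {R κ ι : Type*} [CommRing R] [Fintype κ] (T : Finset ι) (w : ι → R)
    (c : ι → κ → R) (x : κ → R) :
    ∑ k, ∑ l, (∑ i ∈ T, w i * (c i k * c i l) - x k * x l) ^ 2
      = ∑ i ∈ T, ∑ j ∈ T, (∑ k, c i k * c j k) ^ 2 * (w i * w j)
        - 2 * ∑ i ∈ T, w i * (∑ k, c i k * x k) ^ 2 + (∑ k, x k ^ 2) ^ 2 := by
  have h1 : ∑ k, ∑ l, (∑ i ∈ T, w i * (c i k * c i l)) ^ 2
      = ∑ i ∈ T, ∑ j ∈ T, (∑ k, c i k * c j k) ^ 2 * (w i * w j) := by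
    calc _ = ∑ k, ∑ l, ∑ i ∈ T, ∑ j ∈ T,
              w i * (c i k * c i l) * (w j * (c j k * c j l)) := by
            simp only [sq, Finset.sum_mul_sum]
      _ = ∑ k, ∑ i ∈ T, ∑ l, ∑ j ∈ T, w i * (c i k * c i l) * (w j * (c j k * c j l)) :=
            Finset.sum_congr rfl fun k _ => Finset.sum_comm
      _ = ∑ i ∈ T, ∑ k, ∑ l, ∑ j ∈ T, w i * (c i k * c i l) * (w j * (c j k * c j l)) :=
            Finset.sum_comm
      _ = ∑ i ∈ T, ∑ k, ∑ j ∈ T, ∑ l, w i * (c i k * c i l) * (w j * (c j k * c j l)) :=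
            Finset.sum_congr rfl fun i _ => Finset.sum_congr rfl fun k _ => Finset.sum_comm
      _ = ∑ i ∈ T, ∑ j ∈ T, ∑ k, ∑ l, w i * (c i k * c i l) * (w j * (c j k * c j l)) :=
            Finset.sum_congr rfl fun i _ => Finset.sum_comm
      _ = _ := by
            refine Finset.sum_congr rfl fun i _ => Finset.sum_congr rfl fun j _ => ?_
            rw [sq, Finset.sum_mul_sum, Finset.sum_mul]
            refine Finset.sum_congr rfl fun k _ => ?_
            rw [Finset.sum_mul]
            exact Finset.sum_congr rfl fun l _ => by ring
  have h2 : ∑ k, ∑ l, (∑ i ∈ T, w i * (c i k * c i l)) * (x k * x l)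
      = ∑ i ∈ T, w i * (∑ k, c i k * x k) ^ 2 := by
    calc _ = ∑ k, ∑ l, ∑ i ∈ T, w i * (c i k * c i l) * (x k * x l) := by
            simp only [Finset.sum_mul]
      _ = ∑ k, ∑ i ∈ T, ∑ l, w i * (c i k * c i l) * (x k * x l) :=
            Finset.sum_congr rfl fun k _ => Finset.sum_comm
      _ = ∑ i ∈ T, ∑ k, ∑ l, w i * (c i k * c i l) * (x k * x l) := Finset.sum_comm
      _ = _ := by
            refine Finset.sum_congr rfl fun i _ => ?_
            rw [sq, Finset.sum_mul_sum, Finset.mul_sum]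
            refine Finset.sum_congr rfl fun k _ => ?_
            rw [Finset.mul_sum]
            exact Finset.sum_congr rfl fun l _ => by ring
  have h3 : ∑ k, ∑ l, (x k * x l) ^ 2 = (∑ k, x k ^ 2) ^ 2 := by
    rw [sq (∑ k, x k ^ 2), Finset.sum_mul_sum]
    exact Finset.sum_congr rfl fun k _ => Finset.sum_congr rfl fun l _ => by ring
  rw [← h1, ← h2, ← h3, Finset.mul_sum, ← Finset.sum_sub_distrib, ← Finset.sum_add_distrib]
  refine Finset.sum_congr rfl fun k _ => ?_
  rw [Finset.mul_sum, ← Finset.sum_sub_distrib, ← Finset.sum_add_distrib]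
  exact Finset.sum_congr rfl fun l _ => by ring

-- The weights `⟨a_i, x⟩²` are chosen so that the cross term with `x ⊗ x` is exactly the quartic
-- form.
open MvPolynomial Matrix in
theorem sum_sq_tensor_sub_eq {n : ℕ} {ι : Type*} (T : Finset ι) (a : ι → Fin n → ℝ) :
    ∑ k, ∑ l, (∑ i ∈ T, innerPoly (a i) ^ 2 * (C (a i k) * C (a i l)) - X k * X l) ^ 2
      = ∑ i ∈ T, ∑ j ∈ T, C ((a i ⬝ᵥ a j) ^ 2) * (innerPoly (a i) ^ 2 * innerPoly (a j) ^ 2)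
        - 2 * ∑ i ∈ T, innerPoly (a i) ^ 4 + normSqPoly n ^ 2 := by
  have h1 : ∀ i j, (C ((a i ⬝ᵥ a j) ^ 2) : MvPolynomial (Fin n) ℝ)
      = (∑ k, C (a i k) * C (a j k)) ^ 2 := fun i j => by simp [dotProduct]
  have h2 : ∀ i, (innerPoly (a i) ^ 4 : MvPolynomial (Fin n) ℝ)
      = innerPoly (a i) ^ 2 * (∑ k, C (a i k) * X k) ^ 2 := fun i => by
    rw [← innerPoly, ← pow_add]
  simp only [h1, h2, normSqPoly]
  exact sum_sq_tensor_sub (R := MvPolynomial (Fin n) ℝ) T (fun i => innerPoly (a i) ^ 2)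
    (fun i k => C (a i k)) X

open MvPolynomial Matrix in
/-- The quartic form of unit vectors of coherence at most `g` and frame bound `t`. -/
theorem sum_innerPoly_pow_four_certificate {n : ℕ} {ι : Type*} (T : Finset ι)
    (a : ι → Fin n → ℝ) {t g : ℝ} (ht : 0 ≤ t) (hunit : ∀ i ∈ T, a i ⬝ᵥ a i = 1)
    (hg : ∀ i ∈ T, ∀ j ∈ T, i ≠ j → (a i ⬝ᵥ a j) ^ 2 ≤ g ^ 2)
    (h : ∀ x : Fin n → ℝ, ∑ i ∈ T, (a i ⬝ᵥ x) ^ 2 ≤ t * (x ⬝ᵥ x)) :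
    C ((1 + g ^ 2 * t ^ 2) / (1 + g ^ 2)) * normSqPoly n ^ 2 - ∑ i ∈ T, innerPoly (a i) ^ 4
      ∈ sosCone n 2 := by
  classical
  obtain ⟨r, hr⟩ : ∃ r, r = normSqPoly n := ⟨_, rfl⟩
  obtain ⟨S, hS⟩ : ∃ S, S = ∑ i ∈ T, innerPoly (a i) ^ 4 := ⟨_, rfl⟩
  obtain ⟨Y, hY⟩ : ∃ Y, Y = ∑ i ∈ T, innerPoly (a i) ^ 2 := ⟨_, rfl⟩
  rw [← hr, ← hS]
  have hYc : Y ∈ sosCone n 1 := by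
    rw [hY]
    exact sum_mem fun i _ => sq_mem_sosCone (totalDegree_innerPoly_le _)
  -- The product is `t² r² - Y²`; both factors are sums of squares of linear forms.
  have h1 : (C t * r - Y) * (C t * r + Y) ∈ sosCone n 2 := by
    refine mul_mem_sosCone_two ?_ (add_mem (C_mul_mem_sosCone ht ?_) hYc)
    · rw [hr, hY]; exact normSqPoly_sub_sum_sq_mem_sosCone T a h
    · rw [hr]; exact normSqPoly_mem_sosCone n
  have hsq : ∀ i j, innerPoly (a i) ^ 2 * innerPoly (a j) ^ 2 ∈ sosCone n 2 := fun i j =>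
    mul_mem_sosCone_two (sq_mem_sosCone (totalDegree_innerPoly_le _))
      (sq_mem_sosCone (totalDegree_innerPoly_le _))
  -- Squared Gram entries are at most 1 on the diagonal and `g²` off it, so the comparison holds
  -- coefficient by coefficient.
  have h2 : ∑ i ∈ T, ∑ j ∈ T, C ((if i = j then 1 else g ^ 2) - (a i ⬝ᵥ a j) ^ 2) *
      (innerPoly (a i) ^ 2 * innerPoly (a j) ^ 2) ∈ sosCone n 2 := by
    refine sum_mem fun i hi => sum_mem fun j hj => C_mul_mem_sosCone ?_ (hsq i j)
    split_ifs with hij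
    · subst hij; rw [hunit i hi]; norm_num
    · exact sub_nonneg.2 (hg i hi j hj hij)
  have h3 := sum_sq_tensor_sub_eq T a
  have h4 : ∑ k, ∑ l, (∑ i ∈ T, innerPoly (a i) ^ 2 * (C (a i k) * C (a i l)) - X k * X l) ^ 2
      ∈ sosCone n 2 := by
    refine sum_mem fun k _ => sum_mem fun l _ => sq_mem_sosCone ?_
    refine (totalDegree_sub _ _).trans (max_le ?_ ?_)
    · refine totalDegree_finsetSum_le fun i _ => (totalDegree_mul _ _).trans ?_
      have h5 : (innerPoly (a i) ^ 2).totalDegree ≤ 2 * 1 :=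
        (totalDegree_pow _ _).trans (Nat.mul_le_mul_left _ (totalDegree_innerPoly_le _))
      have h6 : (C (a i k) * C (a i l) : MvPolynomial (Fin n) ℝ).totalDegree = 0 := by
        rw [← C_mul, totalDegree_C]
      omega
    · exact (totalDegree_mul _ _).trans (by simp)
  have h5 : ∑ i ∈ T, ∑ j ∈ T, C (if i = j then 1 else g ^ 2) *
      (innerPoly (a i) ^ 2 * innerPoly (a j) ^ 2) = C (g ^ 2) * Y ^ 2 + C (1 - g ^ 2) * S := by
    have : ∀ i j : ι, (C (if i = j then (1 : ℝ) else g ^ 2) : MvPolynomial (Fin n) ℝ)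
        = C (g ^ 2) + if i = j then C (1 - g ^ 2) else 0 := by
      intro i j; split_ifs
      · rw [← C_add]; ring_nf
      · rw [add_zero]
    simp only [this, add_mul, Finset.sum_add_distrib, ite_mul, zero_mul, Finset.sum_ite_eq]
    rw [hY, hS, sq (∑ i ∈ T, _), Finset.sum_mul_sum, Finset.mul_sum, Finset.mul_sum]
    congr 1
    · simp [Finset.mul_sum]
    · refine Finset.sum_congr rfl fun i hi => ?_
      rw [if_pos hi]; ring
  simp only [C_sub, sub_mul, Finset.sum_sub_distrib] at h2
  rw [h5] at h2
  rw [h3, ← hr, ← hS] at h4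
  obtain ⟨D, hD⟩ : ∃ D, D = ∑ i ∈ T, ∑ j ∈ T, C ((a i ⬝ᵥ a j) ^ 2) *
      (innerPoly (a i) ^ 2 * innerPoly (a j) ^ 2) := ⟨_, rfl⟩
  rw [← hD] at h2 h4
  -- `h2 + h4 + g² h1`: the double sum `D` and the terms in `Y²` cancel.
  have h6 : C (1 + g ^ 2 * t ^ 2) * r ^ 2 - C (1 + g ^ 2) * S ∈ sosCone n 2 := by
    have := add_mem (add_mem h2 h4) (C_mul_mem_sosCone (sq_nonneg g) h1)
    have e : C (1 + g ^ 2 * t ^ 2) * r ^ 2 - C (1 + g ^ 2) * S =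
        C (g ^ 2) * Y ^ 2 + C (1 - g ^ 2) * S - D + (D - 2 * S + r ^ 2)
          + C (g ^ 2) * ((C t * r - Y) * (C t * r + Y)) := by
      simp only [C_add, C_mul, C_sub, C_pow, C_1]
      ring
    rw [e]
    exact this
  have hpos : 0 < 1 + g ^ 2 := by positivity
  have := C_mul_mem_sosCone (inv_nonneg.2 hpos.le) h6
  rwa [mul_sub, ← mul_assoc, ← mul_assoc, ← C_mul, ← C_mul, inv_mul_cancel₀ hpos.ne', C_1,
    one_mul, ← div_eq_inv_mul] at this

open MvPolynomial in
theorem totalDegree_sum_innerPoly_pow_four_le {n : ℕ} {ι : Type*} (T : Finset ι)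
    (a : ι → Fin n → ℝ) : (∑ i ∈ T, innerPoly (a i) ^ 4).totalDegree ≤ 4 :=
  totalDegree_finsetSum_le fun _ _ => (totalDegree_pow _ _).trans
    (Nat.mul_le_mul_left _ (totalDegree_innerPoly_le _))

open Matrix in
/-- Frame bound from coherence (Gershgorin). -/
theorem sum_dotProduct_sq_le_of_coherence {n : ℕ} {ι : Type*} [Fintype ι]
    (a : ι → Fin n → ℝ) {g : ℝ} (hg0 : 0 ≤ g) (hunit : ∀ i, a i ⬝ᵥ a i = 1)
    (hg : ∀ i j, i ≠ j → |a i ⬝ᵥ a j| ≤ g) (x : Fin n → ℝ) :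
    ∑ i, (a i ⬝ᵥ x) ^ 2 ≤ (1 + Fintype.card ι * g) * (x ⬝ᵥ x) := by
  classical
  set y := fun i => a i ⬝ᵥ x with hy
  -- Since `⟨z, x⟩ = Y`, Cauchy–Schwarz gives `Y² ≤ ‖z‖² ‖x‖²`. Bounding the off-diagonal terms of
  -- `‖z‖²` by AM-GM gives `‖z‖² ≤ (1 + card ι * g) Y`, and one factor `Y` is then cancelled.
  set z : Fin n → ℝ := ∑ i, y i • a i with hz
  set Y := ∑ i, y i ^ 2 with hY
  have hzx : z ⬝ᵥ x = Y := by
    simp [hz, sum_dotProduct, hY, hy, sq]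
  have hzz : z ⬝ᵥ z ≤ (1 + Fintype.card ι * g) * Y := by
    have h1 : z ⬝ᵥ z = ∑ i, ∑ j, y i * y j * (a i ⬝ᵥ a j) := by
      simp only [hz, sum_dotProduct, dotProduct_sum, smul_dotProduct, dotProduct_smul, smul_eq_mul]
      refine Finset.sum_congr rfl fun i _ => ?_
      rw [Finset.mul_sum]
      refine Finset.sum_congr rfl fun j _ => ?_
      rw [dotProduct_comm]; ring
    have h2 : ∀ i j, y i * y j * (a i ⬝ᵥ a j)
        ≤ (if i = j then y i ^ 2 else 0) + g * ((y i ^ 2 + y j ^ 2) / 2) := by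
      intro i j
      split_ifs with hij
      · subst hij; rw [hunit]; nlinarith [mul_nonneg hg0 (sq_nonneg (y i))]
      · have h3 : |y i * y j| ≤ (y i ^ 2 + y j ^ 2) / 2 := by
          rw [abs_le]; constructor <;> nlinarith [sq_nonneg (y i + y j), sq_nonneg (y i - y j)]
        calc y i * y j * (a i ⬝ᵥ a j) ≤ |y i * y j| * |a i ⬝ᵥ a j| := by
              rw [← abs_mul]; exact le_abs_self _
          _ ≤ ((y i ^ 2 + y j ^ 2) / 2) * g :=
              mul_le_mul h3 (hg i j hij) (abs_nonneg _) (by positivity)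
          _ = _ := by ring
    rw [h1]
    refine (Finset.sum_le_sum fun i _ => Finset.sum_le_sum fun j _ => h2 i j).trans (le_of_eq ?_)
    simp only [Finset.sum_add_distrib, Finset.sum_ite_eq, Finset.mem_univ, if_true,
      ← Finset.mul_sum, ← Finset.sum_div, Finset.sum_const, Finset.card_univ, nsmul_eq_mul]
    rw [← hY]; ring
  have hcs : (z ⬝ᵥ x) ^ 2 ≤ (z ⬝ᵥ z) * (x ⬝ᵥ x) := by
    simp only [dotProduct, ← sq]
    exact Finset.sum_mul_sq_le_sq_mul_sq _ _ _
  have hx : 0 ≤ x ⬝ᵥ x := Finset.sum_nonneg fun k _ => mul_self_nonneg _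
  have hY0 : 0 ≤ Y := Finset.sum_nonneg fun k _ => sq_nonneg _
  rw [hzx] at hcs
  rcases hY0.eq_or_lt with h0 | h0
  · rw [← h0]; positivity
  · refine le_of_mul_le_mul_left ?_ h0
    nlinarith [mul_le_mul_of_nonneg_right hzz hx]

/-! ### Uniform sign vectors: exponential moments and coherence -/

theorem signCube_eq_coe_piFinset (n : ℕ) :
    signCube n = ↑(Fintype.piFinset fun _ : Fin n => ({1 / √n, -(1 / √n)} : Finset ℝ)) := by
  ext v
  simp [signCube]

theorem finite_signCube (n : ℕ) : (signCube n).Finite := by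
  rw [signCube_eq_coe_piFinset]; exact Finset.finite_toSet _

theorem nonempty_signCube (n : ℕ) : (signCube n).Nonempty := ⟨fun _ => 1 / √n, fun _ => Or.inl rfl⟩

instance isProbabilityMeasure_uniformOn_signCube (n : ℕ) :
    IsProbabilityMeasure (uniformOn (signCube n)) :=
  isProbabilityMeasure_uniformOn (finite_signCube n) (nonempty_signCube n)

instance isProbabilityMeasure_componentLaw (m n : ℕ) :
    IsProbabilityMeasure (componentLaw m n) := by
  unfold componentLaw; infer_instance

theorem ae_mem_signCube (n : ℕ) : ∀ᵐ v ∂uniformOn (signCube n), v ∈ signCube n :=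
  ae_cond_mem (finite_signCube n).measurableSet

theorem integrable_uniformOn_of_finite {Ω : Type*} [MeasurableSpace Ω] [MeasurableSingletonClass Ω]
    {s : Set Ω} (hs : s.Finite) (f : Ω → ℝ) : Integrable f (uniformOn s) := by
  rcases s.eq_empty_or_nonempty with rfl | hne
  · simp
  refine Integrable.smul_measure ?_ ?_
  · change IntegrableOn f s Measure.count
    rw [← Set.biUnion_of_singleton s, integrableOn_finite_biUnion hs]
    intro i _
    rw [integrableOn_singleton_iff]
    simp
  · simp [Measure.count_eq_zero_iff, hne.ne_empty]

theorem integral_uniformOn_finset {Ω : Type*} [MeasurableSpace Ω] [MeasurableSingletonClass Ω]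
    (s : Finset Ω) (f : Ω → ℝ) :
    ∫ x, f x ∂uniformOn (s : Set Ω) = (s.card : ℝ)⁻¹ * ∑ x ∈ s, f x := by
  have hi := integrable_uniformOn_of_finite s.finite_toSet f
  rcases s.eq_empty_or_nonempty with rfl | hne
  · simp
  rw [uniformOn, ProbabilityTheory.cond, integral_smul_measure, setIntegral_finset]
  · simp [measureReal_def]
  · change IntegrableOn f s Measure.count
    rw [← Set.biUnion_of_singleton (s : Set Ω), integrableOn_finite_biUnion s.finite_toSet]
    intro i _
    rw [integrableOn_singleton_iff]
    simp

/-- A linear functional of a uniform sign vector is subgaussian. -/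
theorem integral_exp_sum_uniformOn_signCube_le {n : ℕ} (hn : 0 < n) (w : Fin n → ℝ) :
    ∫ v, Real.exp (∑ k, w k * v k) ∂uniformOn (signCube n)
      ≤ Real.exp ((∑ k, w k ^ 2) / (2 * n)) := by
  have hr : (0 : ℝ) < 1 / √n := by positivity
  have hne : (1 / √n : ℝ) ≠ -(1 / √n) := by linarith
  rw [signCube_eq_coe_piFinset, integral_uniformOn_finset]
  simp only [Real.exp_sum]
  rw [← Finset.prod_univ_sum (fun _ : Fin n => ({1 / √n, -(1 / √n)} : Finset ℝ))
    fun k x => Real.exp (w k * x)]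
  rw [Fintype.card_piFinset]
  push_cast
  rw [← Finset.prod_inv_distrib, ← Finset.prod_mul_distrib, Finset.sum_div, Real.exp_sum]
  refine Finset.prod_le_prod (fun k _ => ?_) fun k _ => ?_
  · exact mul_nonneg (by positivity) (Finset.sum_nonneg fun x _ => (Real.exp_pos _).le)
  · rw [Finset.sum_pair hne, Finset.card_pair hne]
    -- Each coordinate averages to a `cosh`, bounded by `cosh y ≤ exp (y² / 2)`.
    have h := Real.cosh_le_exp_half_sq (w k * (1 / √n))
    rw [Real.cosh_eq] at h
    have e : (w k * (1 / √n)) ^ 2 / 2 = w k ^ 2 / (2 * n) := by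
      rw [mul_pow, div_pow, Real.sq_sqrt (by positivity)]
      field_simp
    rw [e] at h
    rw [mul_neg]
    push_cast
    linarith

theorem integrable_exp_sum_componentLaw {m n : ℕ} (W : Fin m → Fin n → ℝ) :
    Integrable (fun a => Real.exp (∑ i, ∑ k, W i k * a i k)) (componentLaw m n) := by
  simp only [Real.exp_sum (s := (Finset.univ : Finset (Fin m)))]
  exact Integrable.fintype_prod (μ := fun _ : Fin m => uniformOn (signCube n))
    (f := fun i (v : Fin n → ℝ) => Real.exp (∑ k, W i k * v k))
    fun i => integrable_uniformOn_of_finite (finite_signCube n) _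

theorem integral_exp_sum_componentLaw_le {m n : ℕ} (hn : 0 < n) (W : Fin m → Fin n → ℝ) :
    ∫ a, Real.exp (∑ i, ∑ k, W i k * a i k) ∂componentLaw m n
      ≤ Real.exp ((∑ i, ∑ k, W i k ^ 2) / (2 * n)) := by
  simp only [Real.exp_sum (s := (Finset.univ : Finset (Fin m))), Finset.sum_div (Finset.univ)
    (fun i => ∑ k, W i k ^ 2)]
  rw [componentLaw, integral_fintype_prod_eq_prod (fun i (v : Fin n → ℝ) => Real.exp (∑ k, W i k * v k))]
  exact Finset.prod_le_prod (fun i _ => integral_nonneg fun v => (Real.exp_pos _).le)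
    fun i _ => integral_exp_sum_uniformOn_signCube_le hn (W i)

open Matrix in
theorem dotProduct_self_of_mem_signCube {n : ℕ} (hn : 0 < n) {v : Fin n → ℝ}
    (hv : v ∈ signCube n) : v ⬝ᵥ v = 1 := by
  have h : ∀ k, v k * v k = 1 / n := by
    intro k
    have hs : √(n : ℝ) * √n = n := Real.mul_self_sqrt (by positivity)
    rcases hv k with h | h <;> rw [h]
    · rw [div_mul_div_comm, hs, one_mul]
    · rw [neg_mul_neg, div_mul_div_comm, hs, one_mul]
  simp only [dotProduct, h]
  simp
  field_simp

theorem ae_componentLaw_mem_signCube (m n : ℕ) :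
    ∀ᵐ a ∂componentLaw m n, ∀ i, a i ∈ signCube n := by
  rw [ae_all_iff]
  intro i
  exact (measurePreserving_eval (fun _ : Fin m => uniformOn (signCube n)) i).quasiMeasurePreserving.ae
    (ae_mem_signCube n)

open Matrix in
/-- Hoeffding's inequality for a sign vector against a fixed unit vector. -/
theorem measure_lt_dotProduct_le {n : ℕ} (hn : 0 < n) {w : Fin n → ℝ} (hw : w ⬝ᵥ w = 1)
    {g : ℝ} (hg : 0 ≤ g) :
    uniformOn (signCube n) {v | g < |v ⬝ᵥ w|} ≤ ENNReal.ofReal (2 * Real.exp (-(n * g ^ 2 / 2))) := by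
  have key : ∀ u : Fin n → ℝ, u ⬝ᵥ u = 1 → (uniformOn (signCube n)).real {v | g ≤ v ⬝ᵥ u}
      ≤ Real.exp (-(n * g ^ 2 / 2)) := by
    intro u hu
    -- Chernoff: the parameter `n * g` minimizes `t² / (2n) - t g`.
    have h := measure_ge_le_exp_mul_mgf (μ := uniformOn (signCube n)) (X := fun v => v ⬝ᵥ u)
      (t := n * g) g (by positivity) (integrable_uniformOn_of_finite (finite_signCube n) _)
    refine h.trans ?_
    have h2 : mgf (fun v => v ⬝ᵥ u) (uniformOn (signCube n)) (n * g)
        ≤ Real.exp (n * g ^ 2 / 2) := by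
      have := integral_exp_sum_uniformOn_signCube_le hn (fun k => n * g * u k)
      have e : (∑ k, (n * g * u k) ^ 2) / (2 * n) = n * g ^ 2 / 2 := by
        have : ∑ k, (n * g * u k) ^ 2 = (n * g) ^ 2 := by
          rw [← mul_one ((n * g) ^ 2), ← hu, dotProduct, Finset.mul_sum]
          exact Finset.sum_congr rfl fun k _ => by ring
        rw [this]; field_simp
      rw [e] at this
      refine le_trans (le_of_eq ?_) this
      rw [mgf]
      congr 1
      ext v
      simp only [dotProduct, Finset.mul_sum]
      congr 1
      exact Finset.sum_congr rfl fun k _ => by ring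
    calc _ ≤ Real.exp (-(n * g) * g) * Real.exp (n * g ^ 2 / 2) := by gcongr
      _ = _ := by rw [← Real.exp_add]; ring_nf
  have hsub : {v : Fin n → ℝ | g < |v ⬝ᵥ w|} ⊆ {v | g ≤ v ⬝ᵥ w} ∪ {v | g ≤ v ⬝ᵥ (-w)} := by
    intro v hv
    rcases lt_abs.1 (show g < |v ⬝ᵥ w| from hv) with h | h
    · exact Or.inl h.le
    · right; simpa using h.le
  refine (measure_mono hsub).trans ((measure_union_le _ _).trans ?_)
  rw [two_mul, ENNReal.ofReal_add (Real.exp_pos _).le (Real.exp_pos _).le]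
  refine add_le_add ?_ ?_
  · rw [← ofReal_measureReal]
    exact ENNReal.ofReal_le_ofReal (key w hw)
  · rw [← ofReal_measureReal]
    exact ENNReal.ofReal_le_ofReal (key (-w) (by simpa using hw))

-- Given `a j`, almost surely a unit vector, the vector `a i` is still uniform, so the fixed-vector
-- bound integrates over the product law.
open Matrix in
theorem componentLaw_lt_dotProduct_le {m n : ℕ} (hn : 0 < n) {i j : Fin m} (hij : i ≠ j)
    {g : ℝ} (hg : 0 ≤ g) :
    componentLaw m n {a | g < |a i ⬝ᵥ a j|} ≤ ENNReal.ofReal (2 * Real.exp (-(n * g ^ 2 / 2))) := by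
  have hind : iIndepFun (fun (i : Fin m) (a : Fin m → Fin n → ℝ) => a i) (componentLaw m n) :=
    iIndepFun_pi (X := fun _ v => v) fun i => aemeasurable_id
  have hmap := (indepFun_iff_map_prod_eq_prod_map_map
    (measurable_pi_apply j).aemeasurable (measurable_pi_apply i).aemeasurable).1
    (hind.indepFun hij.symm)
  have hev : ∀ i, (componentLaw m n).map (fun a => a i) = uniformOn (signCube n) := fun i =>
    (measurePreserving_eval (fun _ : Fin m => uniformOn (signCube n)) i).map_eq
  rw [hev, hev] at hmap
  have hms : MeasurableSet {p : (Fin n → ℝ) × (Fin n → ℝ) | g < |p.2 ⬝ᵥ p.1|} := by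
    refine measurableSet_lt measurable_const ?_
    simp only [dotProduct]
    fun_prop
  have h1 : componentLaw m n {a | g < |a i ⬝ᵥ a j|}
      = ((uniformOn (signCube n)).prod (uniformOn (signCube n)))
          {p : (Fin n → ℝ) × (Fin n → ℝ) | g < |p.2 ⬝ᵥ p.1|} := by
    rw [← hmap, Measure.map_apply (by fun_prop) hms]
    rfl
  rw [h1, Measure.prod_apply hms]
  calc _ ≤ ∫⁻ _, ENNReal.ofReal (2 * Real.exp (-(n * g ^ 2 / 2))) ∂uniformOn (signCube n) := by
        refine lintegral_mono_ae ?_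
        filter_upwards [ae_mem_signCube n] with w hw
        exact measure_lt_dotProduct_le hn (dotProduct_self_of_mem_signCube hn hw) hg
    _ = _ := by simp

/-! ### Frame bounds by volume averaging -/

open Metric in
/-- A supremum over the unit ball of a finite-dimensional space is controlled by averaging: if
every point of `bad` makes `f` at least `K` on some small ball centred in the unit ball, then
`bad` is small. -/
theorem mul_measure_le_of_ball_average {Ω V : Type*} [MeasurableSpace Ω] (P : Measure Ω)
    [SFinite P] [NormedAddCommGroup V] [NormedSpace ℝ V] [FiniteDimensional ℝ V]
    [MeasurableSpace V] [BorelSpace V] (μ : Measure V) [μ.IsAddHaarMeasure]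
    (f : Ω → V → ENNReal) (hf : Measurable (Function.uncurry f)) {M K : ENNReal}
    (hM : ∀ w ∈ ball (0 : V) (6 / 5), ∫⁻ ω, f ω w ∂P ≤ M) (bad : Set Ω)
    (hbad : ∀ ω ∈ bad, ∃ u : V, ‖u‖ ≤ 1 ∧ ∀ w ∈ ball u (1 / 5), K ≤ f ω w) :
    K * P bad ≤ ENNReal.ofReal (6 ^ Module.finrank ℝ V) * M := by
  set c := μ (ball (0 : V) (1 / 5)) with hc
  have hc0 : c ≠ 0 := (measure_ball_pos μ _ (by norm_num)).ne'
  have hct : c ≠ ⊤ := measure_ball_lt_top.ne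
  have hbig : μ (ball (0 : V) (6 / 5)) = ENNReal.ofReal (6 ^ Module.finrank ℝ V) * c := by
    rw [hc, ← Measure.addHaar_ball_mul_of_pos μ (0 : V) (by norm_num : (0 : ℝ) < 6)]
    norm_num
  -- The ball of radius 6/5 contains every ball of radius 1/5 centred in the unit ball, so `F ≥ K c`
  -- on `bad`. Tonelli bounds the mean of `F`, and Markov concludes; the volume ratio is `6 ^ dim`.
  set F : Ω → ENNReal := fun ω => ∫⁻ w in ball (0 : V) (6 / 5), f ω w ∂μ with hF
  have hFm : Measurable F := hf.lintegral_prod_right'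
  have h1 : ∀ ω ∈ bad, K * c ≤ F ω := by
    intro ω hω
    obtain ⟨u, hu, hw⟩ := hbad ω hω
    have hsub : ball u (1 / 5) ⊆ ball (0 : V) (6 / 5) := by
      refine ball_subset_ball' ?_
      rw [dist_zero_right]; linarith
    calc K * c = K * μ (ball u (1 / 5)) := by rw [hc, Measure.addHaar_ball_center μ u]
      _ = ∫⁻ _ in ball u (1 / 5), K ∂μ := by simp
      _ ≤ ∫⁻ w in ball u (1 / 5), f ω w ∂μ := setLIntegral_mono' measurableSet_ball hw
      _ ≤ F ω := lintegral_mono_set hsub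
  have h2 : ∫⁻ ω, F ω ∂P ≤ M * μ (ball (0 : V) (6 / 5)) := by
    rw [hF, lintegral_lintegral_swap hf.aemeasurable]
    calc _ ≤ ∫⁻ _ in ball (0 : V) (6 / 5), M ∂μ := setLIntegral_mono' measurableSet_ball hM
      _ = _ := by simp
  have h3 : K * c * P bad ≤ M * (ENNReal.ofReal (6 ^ Module.finrank ℝ V) * c) := by
    rw [← hbig]
    refine le_trans ?_ ((mul_meas_ge_le_lintegral hFm (K * c)).trans h2)
    gcongr
    exact h1
  rw [← ENNReal.mul_le_mul_iff_left hc0 hct]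
  calc _ = K * c * P bad := by ring
    _ ≤ _ := h3
    _ = _ := by ring

/-- The map `x ↦ (⟨aᵢ, x⟩)_{i ∈ T}` between Euclidean spaces. -/
noncomputable def analysisMap {m n : ℕ} (T : Finset (Fin m)) (a : Fin m → Fin n → ℝ) :
    EuclideanSpace ℝ (Fin n) →L[ℝ] EuclideanSpace ℝ T :=
  LinearMap.toContinuousLinearMap (Matrix.toEuclideanLin (Matrix.of fun (i : T) k => a i k))

open Matrix in
theorem analysisMap_apply {m n : ℕ} (T : Finset (Fin m)) (a : Fin m → Fin n → ℝ)
    (x : EuclideanSpace ℝ (Fin n)) (i : T) : analysisMap T a x i = a i ⬝ᵥ x.ofLp := rfl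

theorem inner_analysisMap {m n : ℕ} (T : Finset (Fin m)) (a : Fin m → Fin n → ℝ)
    (x : EuclideanSpace ℝ (Fin n)) (y : EuclideanSpace ℝ T) :
    inner ℝ y (analysisMap T a x) = ∑ i : T, ∑ k, y i * x k * a i k := by
  simp only [PiLp.inner_apply, analysisMap_apply, dotProduct, RCLike.inner_apply, conj_trivial,
    Finset.sum_mul]
  exact Finset.sum_congr rfl fun i _ => Finset.sum_congr rfl fun k _ => by ring

/-- Near a nearly maximizing pair the bilinear form stays large. The product carries the sup norm,
so both components move by less than 1/5, and with `σ = ‖L‖` the loss is at most `σ/5 + σ/5 + σ/25`,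
leaving `0.55 σ`. -/
theorem exists_inner_ge_half_opNorm {E F : Type*} [NormedAddCommGroup E] [InnerProductSpace ℝ E]
    [NormedAddCommGroup F] [InnerProductSpace ℝ F] (L : E →L[ℝ] F) (hL : 0 < ‖L‖) :
    ∃ u : E × F, ‖u‖ ≤ 1 ∧ ∀ w ∈ Metric.ball u (1 / 5), ‖L‖ / 2 ≤ inner ℝ w.2 (L w.1) := by
  obtain ⟨u, hu1, hu⟩ := L.exists_lt_apply_of_lt_opNorm (r := 0.99 * ‖L‖) (by linarith)
  set σ := ‖L‖
  have hLu : 0 < ‖L u‖ := by nlinarith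
  set v : F := ‖L u‖⁻¹ • L u with hv
  have hv1 : ‖v‖ = 1 := by rw [hv, norm_smul, norm_inv, norm_norm, inv_mul_cancel₀ hLu.ne']
  have hvL : inner ℝ v (L u) = ‖L u‖ := by
    rw [hv, real_inner_smul_left, real_inner_self_eq_norm_sq]
    field_simp
  refine ⟨(u, v), by simp [Prod.norm_def, hu1.le, hv1], fun w hw => ?_⟩
  rw [mem_ball_iff_norm, Prod.norm_def, max_lt_iff] at hw
  obtain ⟨h1, h2⟩ := hw
  simp only [Prod.fst_sub, Prod.snd_sub] at h1 h2
  set p := w.1 - u with hp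
  set q := w.2 - v with hq
  have e1 : w.1 = u + p := by simp [hp]
  have e2 : w.2 = v + q := by simp [hq]
  have hLp : ‖L p‖ ≤ σ / 5 := (L.le_opNorm p).trans (by nlinarith [norm_nonneg p])
  have hLu2 : ‖L u‖ ≤ σ := (L.le_opNorm u).trans (by nlinarith [norm_nonneg u])
  have b1 : |inner ℝ v (L p)| ≤ σ / 5 := (abs_real_inner_le_norm _ _).trans (by rw [hv1]; linarith)
  have b2 : |inner ℝ q (L u)| ≤ σ / 5 :=
    (abs_real_inner_le_norm _ _).trans (by nlinarith [norm_nonneg q])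
  have b3 : |inner ℝ q (L p)| ≤ σ / 25 := (abs_real_inner_le_norm _ _).trans (by
    calc ‖q‖ * ‖L p‖ ≤ (1 / 5) * (σ / 5) := by gcongr
      _ = σ / 25 := by ring)
  rw [e1, e2, map_add, inner_add_left, inner_add_right, inner_add_right, hvL]
  have := neg_le_of_abs_le b1
  have := neg_le_of_abs_le b2
  have := neg_le_of_abs_le b3
  norm_num at *
  linarith

theorem lintegral_exp_inner_analysisMap_le {m n : ℕ} (hn : 0 < n) (T : Finset (Fin m)) {s : ℝ}
    (x : EuclideanSpace ℝ (Fin n)) (y : EuclideanSpace ℝ T) :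
    ∫⁻ a, ENNReal.ofReal (Real.exp (s * inner ℝ y (analysisMap T a x))) ∂componentLaw m n
      ≤ ENNReal.ofReal (Real.exp (s ^ 2 * (‖y‖ ^ 2 * ‖x‖ ^ 2) / (2 * n))) := by
  classical
  -- Extending the coefficients by zero outside `T` lets the moment bound for the whole family
  -- apply.
  set W : Fin m → Fin n → ℝ := fun i k => if h : i ∈ T then s * (y ⟨i, h⟩ * x k) else 0 with hW
  have e1 : ∀ a : Fin m → Fin n → ℝ,
      s * inner ℝ y (analysisMap T a x) = ∑ i, ∑ k, W i k * a i k := by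
    intro a
    rw [inner_analysisMap, ← Finset.sum_subset (Finset.subset_univ T), ← Finset.sum_coe_sort T,
      Finset.mul_sum]
    · refine Finset.sum_congr rfl fun i _ => ?_
      rw [Finset.mul_sum]
      refine Finset.sum_congr rfl fun k _ => ?_
      simp only [hW, i.2, dite_true]; ring
    · intro i _ hi
      simp [hW, hi]
  have e2 : ∑ i, ∑ k, W i k ^ 2 = s ^ 2 * (‖y‖ ^ 2 * ‖x‖ ^ 2) := by
    rw [EuclideanSpace.real_norm_sq_eq, EuclideanSpace.real_norm_sq_eq, Finset.sum_mul_sum,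
      ← Finset.sum_subset (Finset.subset_univ T), ← Finset.sum_coe_sort T, Finset.mul_sum]
    · refine Finset.sum_congr rfl fun i _ => ?_
      rw [Finset.mul_sum]
      refine Finset.sum_congr rfl fun k _ => ?_
      simp only [hW, i.2, dite_true]; ring
    · intro i _ hi
      simp [hW, hi]
  simp only [e1]
  rw [← ofReal_integral_eq_lintegral_ofReal (integrable_exp_sum_componentLaw W)
    (Filter.Eventually.of_forall fun _ => (Real.exp_pos _).le), ← e2]
  exact ENNReal.ofReal_le_ofReal (integral_exp_sum_componentLaw_le hn W)

open Matrix in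
/-- The frame operator of a subfamily of the sign vectors has small norm. -/
theorem componentLaw_frame_bound_fails_le {m n : ℕ} (hn : 0 < n) (T : Finset (Fin m)) {t : ℝ}
    (ht : 0 < t) :
    componentLaw m n {a | ∃ x : Fin n → ℝ, t * (x ⬝ᵥ x) < ∑ i ∈ T, (a i ⬝ᵥ x) ^ 2}
      ≤ ENNReal.ofReal (Real.exp (2 * (n + T.card) - n * t / 20)) := by
  -- Close to the minimizer of `s² (6/5)⁴ / (2n) - s √t / 2`.
  set s : ℝ := n * √t / 4 with hs
  have hs0 : 0 < s := by positivity
  have hst : √t ^ 2 = t := Real.sq_sqrt ht.le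
  have key := mul_measure_le_of_ball_average (componentLaw m n)
    ((volume : Measure (EuclideanSpace ℝ (Fin n))).prod
      (volume : Measure (EuclideanSpace ℝ T)))
    (fun a w => ENNReal.ofReal (Real.exp (s * inner ℝ w.2 (analysisMap T a w.1)))) ?_
    (M := ENNReal.ofReal (Real.exp (s ^ 2 * (6 / 5) ^ 4 / (2 * n))))
    (K := ENNReal.ofReal (Real.exp (s * (√t / 2)))) ?_
    {a | ∃ x : Fin n → ℝ, t * (x ⬝ᵥ x) < ∑ i ∈ T, (a i ⬝ᵥ x) ^ 2} ?_
  · have hfin : Module.finrank ℝ (EuclideanSpace ℝ (Fin n) × EuclideanSpace ℝ T) = n + T.card := by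
      simp
    rw [hfin, ← ENNReal.ofReal_mul (by positivity)] at key
    have h6 : (6 : ℝ) ^ (n + T.card) ≤ Real.exp (2 * (n + T.card)) := by
      have : (6 : ℝ) ≤ Real.exp 2 := by
        have := Real.exp_one_gt_d9
        have e : Real.exp 2 = Real.exp 1 * Real.exp 1 := by rw [← Real.exp_add]; norm_num
        rw [e]; nlinarith
      calc (6 : ℝ) ^ (n + T.card) ≤ Real.exp 2 ^ (n + T.card) := by gcongr
        _ = _ := by rw [← Real.exp_nat_mul]; push_cast; ring_nf
    have hpos := Real.exp_pos (s * (√t / 2))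
    rw [mul_comm, ← ENNReal.le_div_iff_mul_le
      (Or.inl (by simpa using hpos)) (Or.inl ENNReal.ofReal_ne_top),
      ← ENNReal.ofReal_div_of_pos hpos] at key
    refine key.trans (ENNReal.ofReal_le_ofReal ?_)
    rw [div_le_iff₀ hpos]
    calc _ ≤ Real.exp (2 * (n + T.card)) * Real.exp (s ^ 2 * (6 / 5) ^ 4 / (2 * n)) := by gcongr
      _ ≤ _ := by
        rw [← Real.exp_add, ← Real.exp_add]
        refine Real.exp_le_exp.2 ?_
        have e1 : s ^ 2 * (6 / 5) ^ 4 / (2 * n) = (n * t) * ((6 / 5) ^ 4 / 32) := by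
          rw [hs, div_pow, mul_pow, hst]; field_simp; norm_num
        have e2 : s * (√t / 2) = n * t / 8 := by
          rw [hs, show (n : ℝ) * √t / 4 * (√t / 2) = n * √t ^ 2 / 8 by ring, hst]
        rw [e1, e2]
        -- The claim reduces to `(6/5)⁴ / 32 ≤ 1/8 - 1/20`.
        have : 0 < n * t := by positivity
        norm_num
        linarith
  · refine Continuous.measurable ?_
    simp only [inner_analysisMap, Function.uncurry_def]
    refine ENNReal.continuous_ofReal.comp (Real.continuous_exp.comp ?_)
    fun_prop
  · intro w hw
    rw [mem_ball_zero_iff, Prod.norm_def, max_lt_iff] at hw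
    refine (lintegral_exp_inner_analysisMap_le hn T w.1 w.2).trans
      (ENNReal.ofReal_le_ofReal (Real.exp_le_exp.2 ?_))
    have : ‖w.2‖ ^ 2 * ‖w.1‖ ^ 2 ≤ (6 / 5) ^ 2 * (6 / 5) ^ 2 := by
      have := hw.1.le
      have := hw.2.le
      gcongr
    rw [show ((6 : ℝ) / 5) ^ 4 = (6 / 5) ^ 2 * (6 / 5) ^ 2 by norm_num]
    gcongr
  · rintro a ⟨x, hx⟩
    have hL : √t ≤ ‖analysisMap T a‖ := by
      by_contra! hlt
      have h1 := (analysisMap T a).le_opNorm (WithLp.toLp 2 x)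
      have h2 : ‖analysisMap T a (WithLp.toLp 2 x)‖ ^ 2 = ∑ i ∈ T, (a i ⬝ᵥ x) ^ 2 := by
        rw [EuclideanSpace.real_norm_sq_eq, ← Finset.sum_coe_sort T]
        rfl
      have h3 : ‖(WithLp.toLp 2 x : EuclideanSpace ℝ (Fin n))‖ ^ 2 = x ⬝ᵥ x := by
        rw [EuclideanSpace.real_norm_sq_eq]
        simp [dotProduct, sq]
      have h4 : ‖analysisMap T a (WithLp.toLp 2 x)‖ ^ 2
          ≤ (√t * ‖(WithLp.toLp 2 x : EuclideanSpace ℝ (Fin n))‖) ^ 2 := by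
        gcongr
        exact h1.trans (by gcongr)
      rw [mul_pow, hst, h2, h3] at h4
      linarith
    obtain ⟨u, hu, hw⟩ := exists_inner_ge_half_opNorm (analysisMap T a)
      ((Real.sqrt_pos.2 ht).trans_le hL)
    refine ⟨u, hu, fun w hwb => ENNReal.ofReal_le_ofReal (Real.exp_le_exp.2 ?_)⟩
    have := hw w hwb
    gcongr
    linarith

open Matrix in
/-- With overwhelming probability the sign vectors are incoherent and prescribed subfamilies have
bounded frame operators. -/
theorem componentLaw_not_good_le {m n : ℕ} (hn : 0 < n) (q : ℕ) (T : ℕ → Finset (Fin m)) {L : ℝ}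
    (hL : 80 ≤ L) :
    componentLaw m n {a | ¬ ((∀ i, a i ∈ signCube n) ∧
        (∀ i j, i ≠ j → |a i ⬝ᵥ a j| ≤ L / √n) ∧
        ∀ b ∈ Finset.range q, ∀ x : Fin n → ℝ,
          ∑ i ∈ T b, (a i ⬝ᵥ x) ^ 2 ≤ (1 + (T b).card / n) * L * (x ⬝ᵥ x))}
      ≤ ENNReal.ofReal (m ^ 2 * (2 * Real.exp (-(L ^ 2 / 2))) + q * Real.exp (-(n * L / 40))) := by
  set A : Set (Fin m → Fin n → ℝ) := {a | ¬ ∀ i, a i ∈ signCube n} with hA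
  set B : Fin m × Fin m → Set (Fin m → Fin n → ℝ) :=
    fun p => {a | p.1 ≠ p.2 ∧ L / √n < |a p.1 ⬝ᵥ a p.2|} with hB
  set D : ℕ → Set (Fin m → Fin n → ℝ) := fun b => {a | ∃ x : Fin n → ℝ,
    (1 + (T b).card / n) * L * (x ⬝ᵥ x) < ∑ i ∈ T b, (a i ⬝ᵥ x) ^ 2} with hD
  have hsub : {a : Fin m → Fin n → ℝ | ¬ ((∀ i, a i ∈ signCube n) ∧
        (∀ i j, i ≠ j → |a i ⬝ᵥ a j| ≤ L / √n) ∧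
        ∀ b ∈ Finset.range q, ∀ x : Fin n → ℝ,
          ∑ i ∈ T b, (a i ⬝ᵥ x) ^ 2 ≤ (1 + (T b).card / n) * L * (x ⬝ᵥ x))}
      ⊆ A ∪ ((⋃ p ∈ (Finset.univ : Finset (Fin m × Fin m)), B p) ∪ ⋃ b ∈ Finset.range q, D b) := by
    intro a ha
    by_contra hcon
    simp only [Set.mem_union, Set.mem_iUnion, not_or, not_exists, hA, hB, hD, Set.mem_ofPred_eq,
      not_and, not_lt, not_not] at hcon
    exact ha ⟨hcon.1, fun i j hij => hcon.2.1 (i, j) (Finset.mem_univ _) hij,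
      fun b hb x => hcon.2.2 b hb x⟩
  have hA0 : componentLaw m n A = 0 := ae_componentLaw_mem_signCube m n
  have hBp : ∀ p, componentLaw m n (B p) ≤ ENNReal.ofReal (2 * Real.exp (-(L ^ 2 / 2))) := by
    intro p
    by_cases hp : p.1 = p.2
    · simp [hB, hp]
    · refine (measure_mono fun a ha => ha.2).trans
        ((componentLaw_lt_dotProduct_le hn hp (g := L / √n) (by positivity)).trans_eq ?_)
      rw [div_pow, Real.sq_sqrt (by positivity)]
      congr 4
      field_simp
  have hDb : ∀ b, componentLaw m n (D b) ≤ ENNReal.ofReal (Real.exp (-(n * L / 40))) := by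
    intro b
    refine (componentLaw_frame_bound_fails_le hn (T b) (by positivity)).trans
      (ENNReal.ofReal_le_ofReal (Real.exp_le_exp.2 ?_))
    have e : (n : ℝ) * ((1 + (T b).card / n) * L) = (n + (T b).card) * L := by
      field_simp
    rw [e]
    have h1 : (0 : ℝ) ≤ (T b).card := by positivity
    have h2 : (0 : ℝ) ≤ n := by positivity
    -- As `L ≥ 80`, half of the decay `(n + |T|) L / 20` absorbs the dimension cost `2 (n + |T|)`.
    nlinarith [mul_nonneg h1 (by linarith : (0 : ℝ) ≤ L - 80),
      mul_nonneg h2 (by linarith : (0 : ℝ) ≤ L - 80)]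
  refine (measure_mono hsub).trans ((measure_union_le _ _).trans ?_)
  rw [hA0, zero_add]
  refine (measure_union_le _ _).trans ?_
  rw [ENNReal.ofReal_add (by positivity) (by positivity)]
  refine add_le_add ?_ ?_
  · refine (measure_biUnion_finset_le _ _).trans ((Finset.sum_le_sum fun p _ => hBp p).trans_eq ?_)
    rw [Finset.sum_const, nsmul_eq_mul, ENNReal.ofReal_mul (p := (m : ℝ) ^ 2) (by positivity)]
    congr 1
    simp [sq, ENNReal.ofReal_mul]
  · refine (measure_biUnion_finset_le _ _).trans ((Finset.sum_le_sum fun p _ => hDb p).trans_eq ?_)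
    rw [Finset.sum_const, nsmul_eq_mul, ENNReal.ofReal_mul (by positivity)]
    simp

/-! ### Blocks of indices and the three ranges of `m` -/

/-- Indices whose quotient by `s` is `b`. -/
def indexBlock (m s b : ℕ) : Finset (Fin m) := {i | (i : ℕ) / s = b}

theorem card_indexBlock_le (m : ℕ) {s : ℕ} (hs : 0 < s) (b : ℕ) : (indexBlock m s b).card ≤ s := by
  have h := Finset.card_le_card_of_injOn (s := indexBlock m s b) (t := Finset.Ico (b * s) (b * s + s))
    (fun i => (i : ℕ)) (fun i hi => ?_) (fun i _ j _ hij => Fin.ext hij)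
  · simpa using h
  · simp only [indexBlock, Finset.coe_filter, Finset.mem_univ, true_and, Set.mem_ofPred_eq] at hi
    have h1 := Nat.div_add_mod (i : ℕ) s
    have h2 := Nat.mod_lt (i : ℕ) hs
    simp only [Finset.coe_Ico, Set.mem_Ico]
    rw [hi, mul_comm] at h1
    omega

theorem sum_indexBlock {M : Type*} [AddCommMonoid M] (m s : ℕ) (f : Fin m → M) :
    ∑ b ∈ Finset.range (m / s + 1), ∑ i ∈ indexBlock m s b, f i = ∑ i, f i :=
  Finset.sum_fiberwise_of_maps_to (fun i _ => by
    rw [Finset.mem_range]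
    exact Nat.lt_succ_of_le (Nat.div_le_div_right i.2.le)) f

theorem indexBlock_eq_univ {m s : ℕ} (h : m ≤ s) : indexBlock m s 0 = Finset.univ := by
  ext i
  simp [indexBlock, i.2.trans_le h]

/-- Here `u = √n`, `g = L / u` and `t = 1 + m g`. The excess over 1 is `g² (t² - 1) / (1 + g²)`: the
division removes a bare `g²`, which would exceed the target for small `m`. What remains is `2 m g³ +
m² g⁴`. -/
theorem coherence_bound_few {m u L : ℝ} (hm : 0 ≤ m) (hu : 1 ≤ u) (hL : 1 ≤ L) (hmu : m ≤ u) :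
    (1 + (L / u) ^ 2 * (1 + m * (L / u)) ^ 2) / (1 + (L / u) ^ 2)
      ≤ 1 + 20 * L ^ 4 * (m / u ^ 3) := by
  have hu0 : 0 < u := by linarith
  rw [div_le_iff₀ (by positivity)]
  have h1 : (L / u) ^ 2 * (m * (L / u)) ≤ L ^ 4 * (m / u ^ 3) := by
    have : (L / u) ^ 2 * (m * (L / u)) = L ^ 3 * (m / u ^ 3) := by field_simp
    rw [this]
    gcongr
    · norm_num
  have h2 : (L / u) ^ 2 * (m * (L / u)) ^ 2 ≤ L ^ 4 * (m / u ^ 3) := by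
    have : (L / u) ^ 2 * (m * (L / u)) ^ 2 = L ^ 4 * (m / u ^ 3) * (m / u) := by field_simp
    rw [this]
    exact mul_le_of_le_one_right (by positivity) ((div_le_one hu0).2 hmu)
  have h3 : 0 ≤ L ^ 4 * (m / u ^ 3) := by positivity
  have h4 : 0 ≤ L ^ 4 * (m / u ^ 3) * (L / u) ^ 2 := by positivity
  nlinarith

/-- Relative to `L⁴ m / u³`, the three terms of `g² t²` are `u / m`, `2 / u` and `m / u³`, all
bounded when `1 ≤ u ≤ m ≤ u³`. -/
theorem coherence_bound_moderate {m u L : ℝ} (hu : 1 ≤ u) (hmu : u ≤ m)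
    (hmu3 : m ≤ u ^ 3) :
    (1 + (L / u) ^ 2 * ((1 + m / u ^ 2) * L) ^ 2) / (1 + (L / u) ^ 2)
      ≤ 1 + 20 * L ^ 4 * (m / u ^ 3) := by
  have hu0 : 0 < u := by linarith
  have hm0 : 0 < m := by linarith
  have h0 : (1 + (L / u) ^ 2 * ((1 + m / u ^ 2) * L) ^ 2) / (1 + (L / u) ^ 2)
      ≤ 1 + (L / u) ^ 2 * ((1 + m / u ^ 2) * L) ^ 2 :=
    div_le_self (by positivity) (le_add_of_nonneg_right (sq_nonneg _))
  refine h0.trans ?_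
  have h1 : (L / u) ^ 2 * ((1 + m / u ^ 2) * L) ^ 2
      = L ^ 4 * (m / u ^ 3) * (u / m + 2 / u + m / u ^ 3) := by field_simp; ring
  have h2 : u / m ≤ 1 := (div_le_one hm0).2 hmu
  have h3 : 2 / u ≤ 2 := div_le_self (by norm_num) hu
  have h4 : m / u ^ 3 ≤ 1 := (div_le_one (by positivity)).2 hmu3
  rw [h1]
  have h5 : 0 ≤ L ^ 4 * (m / u ^ 3) := by positivity
  nlinarith

/-- A block of size at most `2 u³` has `t ≤ 3 u L`, so `g t ≤ 3 L²` and the total is at most `1 + 9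
L⁴`. -/
theorem coherence_bound_block {c u L : ℝ} (hc : 0 ≤ c) (hu : 1 ≤ u) (hL : 1 ≤ L)
    (hcu : c ≤ 2 * u ^ 3) :
    (1 + (L / u) ^ 2 * ((1 + c / u ^ 2) * L) ^ 2) / (1 + (L / u) ^ 2) ≤ 10 * L ^ 4 := by
  have hu0 : 0 < u := by linarith
  have h0 : (1 + (L / u) ^ 2 * ((1 + c / u ^ 2) * L) ^ 2) / (1 + (L / u) ^ 2)
      ≤ 1 + (L / u) ^ 2 * ((1 + c / u ^ 2) * L) ^ 2 :=
    div_le_self (by positivity) (le_add_of_nonneg_right (sq_nonneg _))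
  refine h0.trans ?_
  have h1 : 1 + c / u ^ 2 ≤ 3 * u := by
    have : c / u ^ 2 ≤ 2 * u := by
      rw [div_le_iff₀ (by positivity)]; nlinarith
    linarith
  have h2 : (L / u) ^ 2 * ((1 + c / u ^ 2) * L) ^ 2 ≤ (L / u) ^ 2 * (3 * u * L) ^ 2 := by
    gcongr
  have h3 : (L / u) ^ 2 * (3 * u * L) ^ 2 = 9 * L ^ 4 := by field_simp; norm_num
  have h4 : 1 ≤ L ^ 4 := one_le_pow₀ hL
  linarith

open Matrix MvPolynomial in
theorem soSLE_of_good {m n : ℕ} (hn : 0 < n) {L : ℝ} (hL : 1 ≤ L) {s : ℕ}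
    (hs1 : √n ^ 3 ≤ s) (hs2 : (s : ℝ) ≤ √n ^ 3 + 1) (hs3 : s ≤ m → √n ^ 3 ≤ m)
    (hs4 : m < s → (m : ℝ) ≤ √n ^ 3) (a : Fin m → Fin n → ℝ)
    (ha : (∀ i, a i ∈ signCube n) ∧ (∀ i j, i ≠ j → |a i ⬝ᵥ a j| ≤ L / √n) ∧
        ∀ b ∈ Finset.range (m / s + 1), ∀ x : Fin n → ℝ, ∑ i ∈ indexBlock m s b, (a i ⬝ᵥ x) ^ 2
          ≤ (1 + (indexBlock m s b).card / n) * L * (x ⬝ᵥ x)) :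
    SoSLE (fun _ : Fin 1 => unitSpherePoly n) 12 (∑ i, innerPoly (a i) ^ 4)
      (C (1 + 20 * L ^ 4 * (m / √n ^ 3))) := by
  obtain ⟨hcube, hcoh, hframe⟩ := ha
  have hu : 1 ≤ √(n : ℝ) := Real.one_le_sqrt.2 (by exact_mod_cast hn)
  have hu2 : √(n : ℝ) ^ 2 = n := Real.sq_sqrt (by positivity)
  have hunit : ∀ i, a i ⬝ᵥ a i = 1 := fun i => dotProduct_self_of_mem_signCube hn (hcube i)
  have hg : 0 ≤ L / √n := by positivity
  have hcoh2 : ∀ i j, i ≠ j → (a i ⬝ᵥ a j) ^ 2 ≤ (L / √n) ^ 2 := fun i j hij =>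
    sq_le_sq' (neg_le_of_abs_le (hcoh i j hij)) (le_of_abs_le (hcoh i j hij))
  have hdeg := totalDegree_sum_innerPoly_pow_four_le Finset.univ a
  have hspos : 0 < s := by
    rw [← Nat.cast_pos (α := ℝ)]
    exact lt_of_lt_of_le (by positivity) hs1
  rcases le_total (m : ℝ) (√n) with hmu | hmu
  · refine soSLE_of_mem_sosCone (coherence_bound_few (Nat.cast_nonneg m) hu hL hmu) hdeg ?_
    refine sum_innerPoly_pow_four_certificate Finset.univ a (by positivity) (fun i _ => hunit i)
      (fun i _ j _ => hcoh2 i j) fun x => ?_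
    simpa using sum_dotProduct_sq_le_of_coherence a hg hunit hcoh x
  rcases lt_or_ge m s with hms | hms
  · refine soSLE_of_mem_sosCone (coherence_bound_moderate hu hmu (hs4 hms)) hdeg ?_
    refine sum_innerPoly_pow_four_certificate Finset.univ a (by positivity) (fun i _ => hunit i)
      (fun i _ j _ => hcoh2 i j) fun x => ?_
    have := hframe 0 (by simp) x
    rw [indexBlock_eq_univ hms.le] at this
    simpa [hu2] using this
  · have hmx : 1 ≤ (m : ℝ) / √n ^ 3 := (one_le_div (by positivity)).2 (hs3 hms)
    -- The extra block costs at most a factor 2, since `m ≥ n^(3/2)`; with `10 L⁴` per block this is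
    -- the constant 20.
    have hq : ((m / s + 1 : ℕ) : ℝ) ≤ 2 * (m / √n ^ 3) := by
      have h1 : ((m / s : ℕ) : ℝ) ≤ m / √n ^ 3 := Nat.cast_div_le.trans (by gcongr)
      push_cast
      linarith
    refine soSLE_of_mem_sosCone (q := ∑ b ∈ Finset.range (m / s + 1),
      (1 + (L / √n) ^ 2 * ((1 + (indexBlock m s b).card / n) * L) ^ 2) / (1 + (L / √n) ^ 2))
      ?_ hdeg ?_
    · calc _ ≤ ∑ b ∈ Finset.range (m / s + 1), 10 * L ^ 4 := by
            refine Finset.sum_le_sum fun b _ => ?_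
            have hc : ((indexBlock m s b).card : ℝ) ≤ s := by
              exact_mod_cast card_indexBlock_le m hspos b
            have h1 : (1 : ℝ) ≤ √n ^ 3 := one_le_pow₀ hu
            have := coherence_bound_block (Nat.cast_nonneg (indexBlock m s b).card) hu hL
              (by linarith)
            rwa [hu2] at this
        _ = ((m / s + 1 : ℕ) : ℝ) * (10 * L ^ 4) := by simp
        _ ≤ 2 * (m / √n ^ 3) * (10 * L ^ 4) := by gcongr
        _ ≤ _ := by linarith
    · rw [map_sum, Finset.sum_mul, ← sum_indexBlock m s, ← Finset.sum_sub_distrib]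
      refine sum_mem fun b hb => ?_
      exact sum_innerPoly_pow_four_certificate _ a (by positivity) (fun i _ => hunit i)
        (fun i _ j _ => hcoh2 i j) (hframe b hb)

/-! ### Failure probability and conclusion -/

theorem failure_probability_le {n m q K : ℕ} {L : ℝ} (hn : 2 ≤ n) (hLe : Real.exp L = n + m)
    (hL : 2 * K + 8 ≤ L) (hnK : 40 * ((K : ℝ) + 3) ≤ n) (hq : q ≤ n + m) :
    m ^ 2 * (2 * Real.exp (-(L ^ 2 / 2))) + q * Real.exp (-(n * L / 40)) ≤ 1 / (n : ℝ) ^ K := by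
  have hn' : (2 : ℝ) ≤ n := by exact_mod_cast hn
  have hm : (0 : ℝ) ≤ m := by positivity
  have hK : (0 : ℝ) ≤ K := by positivity
  set p : ℝ := n + m with hp
  have hp2 : 2 ≤ p := by linarith
  have hexp : ∀ j : ℕ, Real.exp (-(j * L)) = 1 / p ^ j := by
    intro j
    rw [Real.exp_neg, Real.exp_nat_mul, hLe, one_div]
  -- `L / 2 ≥ K + 4` turns the Gaussian tail into a power of `p = exp L`; below, `n / 40 ≥ K + 3`
  -- does the same.
  have h1 : Real.exp (-(L ^ 2 / 2)) ≤ 1 / p ^ (K + 4) := by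
    rw [← hexp]
    refine Real.exp_le_exp.2 ?_
    push_cast
    nlinarith
  have h2 : Real.exp (-(n * L / 40)) ≤ 1 / p ^ (K + 3) := by
    rw [← hexp]
    refine Real.exp_le_exp.2 ?_
    push_cast
    nlinarith
  have hq' : (q : ℝ) ≤ p := by rw [hp]; exact_mod_cast hq
  calc _ ≤ p ^ 2 * (2 * (1 / p ^ (K + 4))) + p * (1 / p ^ (K + 3)) := by
        gcongr
        linarith
    _ = 3 / p ^ 2 * (1 / p ^ K) := by field_simp; ring
    _ ≤ 1 * (1 / p ^ K) := by
        gcongr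
        rw [div_le_one (by positivity)]
        nlinarith
    _ ≤ 1 / (n : ℝ) ^ K := by
        rw [one_mul]
        gcongr
        linarith

theorem mainTheorem5 :
    ∃ (c : ℝ) (k : ℕ), 0 < c ∧ ∀ K : ℕ, ∃ N : ℕ, ∀ n : ℕ, N ≤ n → ∀ m : ℕ,
      1 - 1 / (n : ℝ) ^ K ≤
        (componentLaw m n).real
          {a | SoSLE (fun _ : Fin 1 => unitSpherePoly n) 12
            (∑ i, innerPoly (a i) ^ 4)
            (MvPolynomial.C
              (1 + c * Real.log ((n : ℝ) + (m : ℝ)) ^ k * ((m : ℝ) / (n : ℝ) ^ (3 / 2 : ℝ))))} := by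
  refine ⟨20, 4, by norm_num, fun K => ?_⟩
  -- The 80 serves the frame bound, and `2 K + 8` the coherence tail.
  obtain ⟨N₁, hN₁⟩ := Filter.eventually_atTop.1
    ((Real.tendsto_log_atTop.comp tendsto_natCast_atTop_atTop).eventually_ge_atTop
      (80 + (2 * (K : ℝ) + 8)))
  refine ⟨max N₁ (40 * (K + 3)), fun n hn m => ?_⟩
  have hlog : 80 + (2 * (K : ℝ) + 8) ≤ Real.log n := hN₁ n (le_of_max_le_left hn)
  have hnK : 40 * (K + 3) ≤ n := le_of_max_le_right hn
  have hn0 : 0 < n := by omega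
  have hn0' : (0 : ℝ) < n := by exact_mod_cast hn0
  have hm : (0 : ℝ) ≤ m := by positivity
  have hK : (0 : ℝ) ≤ K := by positivity
  set L := Real.log ((n : ℝ) + m) with hLdef
  have hLn : Real.log n ≤ L := Real.log_le_log hn0' (by linarith)
  have hLe : Real.exp L = n + m := Real.exp_log (by linarith)
  have hpow : (n : ℝ) ^ (3 / 2 : ℝ) = √n ^ 3 := by
    rw [Real.sqrt_eq_rpow, ← Real.rpow_natCast, ← Real.rpow_mul hn0'.le]
    norm_num
  have hx : 0 ≤ √(n : ℝ) ^ 3 := by positivity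
  -- With floor plus one, `m < s` means exactly `m ≤ n^(3/2)`.
  set s : ℕ := ⌊√(n : ℝ) ^ 3⌋₊ + 1 with hs
  have hs1 : √(n : ℝ) ^ 3 ≤ s := by rw [hs]; push_cast; exact (Nat.lt_floor_add_one _).le
  have hs2 : (s : ℝ) ≤ √(n : ℝ) ^ 3 + 1 := by
    rw [hs]; push_cast; linarith [Nat.floor_le hx]
  have hs3 : s ≤ m → √(n : ℝ) ^ 3 ≤ m := fun h => hs1.trans (by exact_mod_cast h)
  have hs4 : m < s → (m : ℝ) ≤ √(n : ℝ) ^ 3 := fun h =>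
    (Nat.le_floor_iff hx).1 (Nat.lt_succ_iff.1 h)
  rw [hpow]
  set E : Set (Fin m → Fin n → ℝ) := {a | SoSLE (fun _ : Fin 1 => unitSpherePoly n) 12
    (∑ i, innerPoly (a i) ^ 4)
    (MvPolynomial.C (1 + 20 * L ^ 4 * ((m : ℝ) / √n ^ 3)))} with hE
  have hbad : componentLaw m n Eᶜ ≤ ENNReal.ofReal (1 / (n : ℝ) ^ K) := by
    refine (measure_mono ?_).trans ((componentLaw_not_good_le hn0 (m / s + 1) (indexBlock m s)
      (L := L) (by linarith)).trans (ENNReal.ofReal_le_ofReal ?_))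
    · intro a ha hgood
      exact ha (soSLE_of_good hn0 (by linarith) hs1 hs2 hs3 hs4 a hgood)
    · refine failure_probability_le (by omega) hLe (by linarith) (by exact_mod_cast hnK) ?_
      have := Nat.div_le_self m s
      omega
  have hbad' : (componentLaw m n).real Eᶜ ≤ 1 / (n : ℝ) ^ K :=
    ENNReal.toReal_le_of_le_ofReal (by positivity) hbad
  -- Subadditivity suffices here and needs no measurability of `E`.
  have hone : 1 ≤ (componentLaw m n).real E + (componentLaw m n).real Eᶜ := by
    have := measureReal_union_le (μ := componentLaw m n) E Eᶜ
    rwa [Set.union_compl_self, probReal_univ] at this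
  linarith
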